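/- Let $X$ be a compact Hausdorff space, $U\subset X$ a dense open subset, and $\partial U=X\setminus U$. Consider the $C^*$-algebra extension $$0\to C_0(U)\xrightarrow{\varphi} C(X)\xrightarrow{\pi} C(\partial U)\to 0 ,\qquad(\ast)$$ where $\varphi$ is extension by zero and $\pi$ is restriction. Put $A=C_0(U)$; regard $V=C_0(U)$ and $Z=C(\partial U)$ as Hilbert $C^*$-modules over themselves. A *Hilbert $C^*$-module extension* $0\to V\xrightarrow{\Phi}W\xrightarrow{\Psi}Z\to0$ over $(\ast)$ consists of a Hilbert $C^*$-module $W$ over $C(X)$ and maps forming a short exact sequence with $\langle\Phi v,\Phi v'\rangle=\varphi(\langle v,v'\rangle)$ and $\langle\Psi w,\Psi w'\rangle=\pi(\langle w,w'\rangle)$ for all $v,v'\in V$ and $w,w'\in W$. Let $M(V)$ be the module of adjointable operators $A\to V$ with inner product $\langle S,T\rangle=S^*T\in M(A)$, let $Q(V)=M(V)/V$ and $Q(A)=M(A)/A$, and let $\delta:C(\partial U)\to Q(A)$ be the Busby invariant of $(\ast)$, that is, $\delta(\pi(b))$ is the class of the multiplier $a\mapsto\varphi^{-1}(\varphi(a)b)$.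 The *Busby invariant* of $W$ is the map $\Delta_W:Z\to Q(V)$ for which $\Delta_W(\Psi(w))$ is the class of the operator $a\mapsto\Phi^{-1}(w\,\varphi(a))$. Two extensions $W_0,W_1$ are *homotopic* if there are maps $\Delta_t:Z\to Q(V)$, $t\in[0,1]$, with $\langle\Delta_t(z),\Delta_t(z')\rangle=\delta(\langle z,z'\rangle)$ for all $z,z'\in Z$, with $\Delta_0=\Delta_{W_0}$ and $\Delta_1=\Delta_{W_1}$, such that $t\mapsto\Delta_t(z)$ is norm-continuous for every $z\in Z$. Then the homotopy classes of Hilbert $C^*$-module extensions $0\to C_0(U)\to W\to C(\partial U)\to0$ over $(\ast)$ are in one-to-one correspondence with the set $[\beta U\setminus U,\mathbb S^1]$ of homotopy classes of continuous maps from the Stone–Čech corona of $U$ to the circle. The correspondence sends the class of $W$ to the class of $\Delta_W(1)$, which is a function $\beta U\setminus U\to\mathbb S^1$ under the canonical identification $Q(V)=C(\beta U)/C_0(U)=C(\beta U\setminus U)$. -/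

import Mathlib

set_option linter.unusedSectionVars false
open scoped ComplexOrder ZeroAtInfty

universe u

namespace HilbertExt

/-! ### Hilbert modules, multiplier modules and their coronas

All `C⋆`-algebras are commutative, so left and right modules agree; a Hilbert module over `A` is
written with `A` acting on the left, and `inner A x y` is the `A`-valued inner product, conjugate
linear in `x` and linear in `y`. In a `CStarModule` the laws of the action of `A` follow from the
laws of the inner product. -/

section Multiplier

variable {A V : Type u} [NonUnitalCommCStarAlgebra A] [PartialOrder A] [StarOrderedRing A]
  [NormedAddCommGroup V] [NormedSpace ℂ V] [SMul A V] [CStarModule A V]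

theorem inner_ext {x y : V} (h : ∀ v : V, inner A v x = inner A v y) : x = y := by
  have h1 : inner A (x - y) (x - y) = 0 := by
    rw [CStarModule.inner_sub_right, h, sub_self]
  exact sub_eq_zero.mp (CStarModule.inner_self.mp h1)

theorem norm_smul_le' (a : A) (v : V) : ‖a • v‖ ≤ ‖a‖ * ‖v‖ := by
  have h : ‖a • v‖ ^ 2 ≤ (‖a‖ * ‖v‖) ^ 2 := by
    rw [CStarModule.norm_sq_eq A, mul_pow, CStarModule.norm_sq_eq A (x := v),
      CStarModule.inner_op_smul_right, CStarModule.inner_op_smul_left]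
    calc ‖a * (inner A v v * star a)‖ ≤ ‖a‖ * (‖inner A v v‖ * ‖star a‖) :=
          (norm_mul_le _ _).trans (by gcongr; exact norm_mul_le _ _)
      _ = ‖a‖ ^ 2 * ‖inner A v v‖ := by rw [norm_star]; ring
  exact (pow_le_pow_iff_left₀ (norm_nonneg _) (by positivity) two_ne_zero).mp h

variable (A V) in
/-- The multiplier module `M(V)`: the adjointable operators from `A` (as a Hilbert module over
itself) to `V`, with the operator norm. For `V = A` it is the multiplier algebra `M(A)`. -/
noncomputable def Mult : Submodule ℂ (A →L[ℂ] V) where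
  carrier := {T | ∃ S : V →L[ℂ] A, ∀ a v, inner A (T a) v = inner A a (S v)}
  add_mem' := by
    rintro T T' ⟨S, hS⟩ ⟨S', hS'⟩
    refine ⟨S + S', fun a v => ?_⟩
    rw [add_apply, add_apply, CStarModule.inner_add_left,
      CStarModule.inner_add_right, hS, hS']
  zero_mem' := ⟨0, fun a v => by simp⟩
  smul_mem' := by
    rintro c T ⟨S, hS⟩
    refine ⟨star c • S, fun a v => ?_⟩
    rw [smul_apply, smul_apply,
      CStarModule.inner_smul_left_complex, CStarModule.inner_smul_right_complex, hS]

/-- The adjoint `T⋆ : V → A` of `T ∈ M(V)`. -/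
noncomputable def adj (T : Mult A V) : V →L[ℂ] A := T.2.choose

theorem adj_spec (T : Mult A V) (a : A) (v : V) :
    inner A (T.1 a) v = inner A a (adj T v) := T.2.choose_spec a v

theorem adj_spec' (T : Mult A V) (a : A) (v : V) :
    inner A v (T.1 a) = inner A (adj T v) a := by
  rw [← CStarModule.star_inner, adj_spec, CStarModule.star_inner]

theorem adj_unique (T : Mult A V) (S : V → A)
    (h : ∀ a v, inner A (T.1 a) v = inner A a (S v)) (v : V) : adj T v = S v :=
  inner_ext (A := A) fun a => by rw [← adj_spec, h]

theorem adj_smul (T : Mult A V) (a : A) (v : V) : adj T (a • v) = a * adj T v := by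
  refine inner_ext (A := A) fun b => ?_
  rw [← adj_spec, CStarModule.inner_op_smul_right, adj_spec]
  exact (CStarModule.inner_op_smul_right (A := A) (E := A)).symm

theorem adj_add (S T : Mult A V) (v : V) : adj (S + T) v = adj S v + adj T v :=
  adj_unique _ (fun v => adj S v + adj T v) (fun a v => by
    rw [Submodule.coe_add, add_apply, CStarModule.inner_add_left, adj_spec,
      adj_spec, CStarModule.inner_add_right]) v

/-- The canonical map `Γ : V → M(V)`, `Γ(v) = l_v`, `l_v(a) = a v`. -/
noncomputable def Gam : V →ₗ[ℂ] Mult A V where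
  toFun v := ⟨LinearMap.mkContinuous
      { toFun := fun a => a • v
        map_add' := fun a b => inner_ext (A := A) fun x => by
          simp [add_mul]
        map_smul' := fun c a => inner_ext (A := A) fun x => by
          simp [smul_mul_assoc] } ‖v‖ (fun a => by
            rw [mul_comm]
            exact norm_smul_le' a v),
    CStarModule.innerSL v, fun a x => by
      change inner A (a • v) x = inner A v x * star a
      exact CStarModule.inner_op_smul_left⟩
  map_add' v w := Subtype.ext <| ContinuousLinearMap.ext fun a => inner_ext (A := A) fun x => by
    change inner A x (a • (v + w)) = inner A x (a • v + a • w)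
    simp [mul_add]
  map_smul' c v := Subtype.ext <| ContinuousLinearMap.ext fun a => inner_ext (A := A) fun x => by
    change inner A x (a • c • v) = inner A x (c • a • v)
    simp [mul_smul_comm]

theorem Gam_apply (v : V) (a : A) : (Gam (A := A) v).1 a = a • v := rfl

/-- The `M(A)`-valued inner product `⟨S, T⟩ = S⋆ T` on `M(V)`. -/
noncomputable def multInner (S T : Mult A V) : Mult A A :=
  ⟨(adj S).comp T.1, (adj T).comp S.1, fun a b => by
    change inner A (adj S (T.1 a)) b = inner A a (adj T (S.1 b))
    rw [← adj_spec', ← adj_spec]⟩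

theorem multInner_apply (S T : Mult A V) (a : A) : (multInner S T).1 a = adj S (T.1 a) := rfl

variable (A V) in
/-- The quotient module `Q(V) = M(V)/V`, with the quotient norm. For `V = A` it is the corona
algebra `Q(A) = M(A)/A`. -/
abbrev Corona : Type u := Mult A V ⧸ LinearMap.range (Gam (A := A) (V := V))

/-- The quotient map `M(V) → Q(V)`. -/
noncomputable def toCorona (T : Mult A V) : Corona A V := Submodule.Quotient.mk T

theorem toCorona_eq_iff {S T : Mult A V} :
    toCorona S = toCorona T ↔ ∃ v : V, Gam (A := A) v = S - T := by
  rw [toCorona, toCorona, Submodule.Quotient.eq, LinearMap.mem_range]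

theorem multInner_congr {S S' T T' : Mult A V} (hS : toCorona S = toCorona S')
    (hT : toCorona T = toCorona T') :
    toCorona (multInner S T) = toCorona (multInner S' T') := by
  obtain ⟨v, hv⟩ := toCorona_eq_iff.mp hS
  obtain ⟨w, hw⟩ := toCorona_eq_iff.mp hT
  rw [toCorona_eq_iff]
  refine ⟨star (adj T v) + adj S' w, Subtype.ext <| ContinuousLinearMap.ext fun a => ?_⟩
  have hS' : S = Gam v + S' := by rw [hv]; abel
  have hT' : T.1 a = T'.1 a + a • w := by
    have : T = T' + Gam w := by rw [hw]; abel
    conv_lhs => rw [this]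
    rfl
  have hG : adj (Gam (A := A) v) (T.1 a) = a * star (adj T v) := by
    rw [adj_unique (Gam (A := A) v) (fun x => inner A v x)
      (fun a x => (CStarModule.inner_op_smul_left : inner A (a • v) x = inner A v x * star a)),
      adj_spec', WithCStarModule.inner_def]
  change a • (star (adj T v) + adj S' w) = adj S (T.1 a) - adj S' (T'.1 a)
  rw [hS', adj_add, hG, hT', map_add, adj_smul, smul_eq_mul, mul_add]
  abel

/-- The `Q(A)`-valued inner product on `Q(V)` induced by the `M(A)`-valued one on `M(V)`. -/
noncomputable def coronaInner (p q : Corona A V) : Corona A A :=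
  Quotient.liftOn₂' p q (fun S T => toCorona (multInner S T)) fun _ _ _ _ hS hT =>
    multInner_congr (Quotient.sound' hS) (Quotient.sound' hT)

theorem coronaInner_mk (S T : Mult A V) :
    coronaInner (toCorona S) (toCorona T) = toCorona (multInner S T) := rfl

end Multiplier

/-! ### Extensions and their Busby invariants -/

/-- An extension `0 → A → B → C → 0` of commutative `C⋆`-algebras (with `B`, `C` unital). -/
structure AlgExtension (A B C : Type u) [NonUnitalCommCStarAlgebra A] [CommCStarAlgebra B]
    [CommCStarAlgebra C] where
  φ : A →⋆ₙₐ[ℂ] B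
  π : B →⋆ₐ[ℂ] C
  injective : Function.Injective φ
  surjective : Function.Surjective π
  exact : ∀ b, π b = 0 ↔ ∃ a, φ a = b

section Extension

variable {A B C : Type u} [NonUnitalCommCStarAlgebra A] [PartialOrder A] [StarOrderedRing A]
  [CommCStarAlgebra B] [PartialOrder B] [StarOrderedRing B]
  [CommCStarAlgebra C] [PartialOrder C] [StarOrderedRing C]

/-- A Hilbert `C⋆`-module extension `0 → V → W → Z → 0` with underlying `C⋆`-algebra extension
`0 → A → B → C → 0`: a (complete) Hilbert module `W` over `B`, and an exact sequence of maps `Φ`,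
`Ψ` which are morphisms of Hilbert modules over `φ : A → B` and `π : B → C`, respectively.
Linearity of `Φ` and `Ψ` is automatic. -/
structure Extension (E : AlgExtension A B C)
    (V : Type u) [NormedAddCommGroup V] [NormedSpace ℂ V] [SMul A V] [CStarModule A V]
    (Z : Type u) [NormedAddCommGroup Z] [NormedSpace ℂ Z] [SMul C Z] [CStarModule C Z] where
  W : Type u
  [normedAddCommGroup : NormedAddCommGroup W]
  [normedSpace : NormedSpace ℂ W]
  [completeSpace : CompleteSpace W]
  [module : Module B W]
  [cstarModule : CStarModule B W]
  Φ : V → W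
  Ψ : W → Z
  inner_Φ : ∀ v v', inner B (Φ v) (Φ v') = E.φ (inner A v v')
  inner_Ψ : ∀ w w', inner C (Ψ w) (Ψ w') = E.π (inner B w w')
  injective : Function.Injective Φ
  surjective : Function.Surjective Ψ
  exact : ∀ w, Ψ w = 0 ↔ ∃ v, Φ v = w

attribute [instance] Extension.normedAddCommGroup Extension.normedSpace Extension.completeSpace
  Extension.module Extension.cstarModule

namespace Extension

variable {E : AlgExtension A B C}
  {V : Type u} [NormedAddCommGroup V] [NormedSpace ℂ V] [SMul A V] [CStarModule A V]
  {Z : Type u} [NormedAddCommGroup Z] [NormedSpace ℂ Z] [SMul C Z] [CStarModule C Z]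
  (W : Extension E V Z)

theorem ext_Φ {w w' : W.W} (h : inner B (w - w') (w - w') = 0) : w = w' :=
  sub_eq_zero.mp (CStarModule.inner_self.mp h)

theorem Φ_add (v v' : V) : W.Φ (v + v') = W.Φ v + W.Φ v' := by
  apply W.ext_Φ
  simp only [CStarModule.inner_sub_left, CStarModule.inner_sub_right, CStarModule.inner_add_left,
    CStarModule.inner_add_right, W.inner_Φ, map_add]
  abel

theorem Φ_smul (c : ℂ) (v : V) : W.Φ (c • v) = c • W.Φ v := by
  apply W.ext_Φ
  simp only [CStarModule.inner_sub_left, CStarModule.inner_sub_right,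
    CStarModule.inner_smul_left_complex,
    CStarModule.inner_smul_right_complex, W.inner_Φ, map_smul, sub_self, smul_zero,
    sub_zero]
  rw [smul_comm, sub_self]

theorem Ψ_sub (w w' : W.W) : W.Ψ (w - w') = W.Ψ w - W.Ψ w' := by
  refine sub_eq_zero.mp ((CStarModule.inner_self (A := C)).mp ?_)
  simp only [CStarModule.inner_sub_left, CStarModule.inner_sub_right, W.inner_Ψ, map_sub]
  abel

theorem norm_Φ (v : V) : ‖W.Φ v‖ = ‖v‖ := by
  rw [CStarModule.norm_eq_sqrt_norm_inner_self (A := B) (W.Φ v),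
    CStarModule.norm_eq_sqrt_norm_inner_self (A := A) v, W.inner_Φ,
    NonUnitalStarAlgHom.norm_map E.φ E.injective]

theorem exists_smul (w : W.W) (a : A) : ∃ v, W.Φ v = E.φ a • w := by
  rw [← W.exact, ← CStarModule.inner_self (A := C), W.inner_Ψ, CStarModule.inner_op_smul_right,
    map_mul, (E.exact (E.φ a)).mpr ⟨a, rfl⟩, zero_mul]

theorem exists_inner (w : W.W) (v : V) : ∃ a, E.φ a = inner B w (W.Φ v) := by
  rw [← E.exact, ← W.inner_Ψ, (W.exact (W.Φ v)).mpr ⟨v, rfl⟩, CStarModule.inner_zero_right]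

/-- The map `Λ : W → M(V)`: `Λ(w)(a)` is the element `v` of `V` with `Φ(v) = φ(a) w`. -/
noncomputable def lam (w : W.W) : Mult A V :=
  ⟨LinearMap.mkContinuous
    { toFun := fun a => (W.exists_smul w a).choose
      map_add' := fun a b => W.injective <| by
        rw [W.Φ_add, (W.exists_smul w _).choose_spec, (W.exists_smul w _).choose_spec,
          (W.exists_smul w _).choose_spec, map_add, add_smul]
      map_smul' := fun c a => W.injective <| by
        rw [RingHom.id_apply, W.Φ_smul, (W.exists_smul w _).choose_spec,
          (W.exists_smul w _).choose_spec, map_smul]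
        refine inner_ext (A := B) fun x => ?_
        simp } ‖w‖ (fun a => by
          change ‖(W.exists_smul w a).choose‖ ≤ _
          rw [← W.norm_Φ, (W.exists_smul w _).choose_spec,
            ← NonUnitalStarAlgHom.norm_map E.φ E.injective, mul_comm]
          exact norm_smul_le' _ _),
    LinearMap.mkContinuous
    { toFun := fun v => (W.exists_inner w v).choose
      map_add' := fun v v' => E.injective <| by
        rw [map_add, (W.exists_inner w _).choose_spec, (W.exists_inner w _).choose_spec,
          (W.exists_inner w _).choose_spec, W.Φ_add, CStarModule.inner_add_right]
      map_smul' := fun c v => E.injective <| by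
        rw [RingHom.id_apply, map_smul, (W.exists_inner w _).choose_spec,
          (W.exists_inner w _).choose_spec, W.Φ_smul, CStarModule.inner_smul_right_complex] }
    ‖w‖ (fun v => by
          change ‖(W.exists_inner w v).choose‖ ≤ _
          rw [← NonUnitalStarAlgHom.norm_map E.φ E.injective, (W.exists_inner w _).choose_spec,
            ← W.norm_Φ]
          exact CStarModule.norm_inner_le W.W),
    fun a v => E.injective <| by
      change E.φ (inner A (W.exists_smul w a).choose v) =
        E.φ ((W.exists_inner w v).choose * star a)
      rw [← W.inner_Φ, (W.exists_smul w _).choose_spec, map_mul,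
        (W.exists_inner w _).choose_spec, CStarModule.inner_op_smul_left, map_star]⟩

theorem Φ_lam (w : W.W) (a : A) : W.Φ ((W.lam w).1 a) = E.φ a • w :=
  (W.exists_smul w a).choose_spec

theorem φ_adj_lam (w : W.W) (v : V) : E.φ (adj (W.lam w) v) = inner B w (W.Φ v) := by
  rw [adj_unique (W.lam w) (fun v => (W.exists_inner w v).choose) (fun a v => E.injective ?_)]
  · exact (W.exists_inner w v).choose_spec
  · rw [← W.inner_Φ, W.Φ_lam, WithCStarModule.inner_def, map_mul,
        (W.exists_inner w _).choose_spec, CStarModule.inner_op_smul_left, map_star]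

theorem toCorona_lam_eq {w w' : W.W} (h : W.Ψ w = W.Ψ w') :
    toCorona (W.lam w) = toCorona (W.lam w') := by
  obtain ⟨v, hv⟩ := (W.exact (w - w')).mp (by rw [W.Ψ_sub, h, sub_self])
  refine toCorona_eq_iff.mpr ⟨v, Subtype.ext <| ContinuousLinearMap.ext fun a => W.injective ?_⟩
  change W.Φ (a • v) = W.Φ ((W.lam w).1 a - (W.lam w').1 a)
  rw [sub_eq_add_neg, ← neg_one_smul ℂ, W.Φ_add, W.Φ_smul, W.Φ_lam, W.Φ_lam, neg_one_smul,
    ← sub_eq_add_neg, ← smul_sub, ← hv]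
  apply W.ext_Φ
  simp only [CStarModule.inner_sub_left, CStarModule.inner_sub_right, W.inner_Φ,
    CStarModule.inner_op_smul_left, CStarModule.inner_op_smul_right, map_mul, map_star]
  ring

/-- The Busby invariant `Δ : Z → Q(V)` of the extension: `Δ(Ψ(w))` is the class of `Λ(w)`. -/
noncomputable def busby (z : Z) : Corona A V :=
  toCorona (W.lam (W.surjective z).choose)

theorem busby_Ψ (w : W.W) : W.busby (W.Ψ w) = toCorona (W.lam w) :=
  W.toCorona_lam_eq (W.surjective (W.Ψ w)).choose_spec

end Extension

/-- The extension `0 → A → B → C → 0`, as an extension of Hilbert modules. -/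
noncomputable def AlgExtension.self (E : AlgExtension A B C) : Extension E A C where
  W := B
  Φ := E.φ
  Ψ := E.π
  inner_Φ v v' := by simp [WithCStarModule.inner_def, map_star]
  inner_Ψ w w' := by simp [WithCStarModule.inner_def, map_star]
  injective := E.injective
  surjective := E.surjective
  exact := E.exact

/-- The Busby invariant `δ : C → Q(A)` of the `C⋆`-algebra extension: `δ(π(b))` is the class of the
multiplier `a ↦ φ⁻¹(φ(a) b)` of `A`. -/
noncomputable def AlgExtension.delta (E : AlgExtension A B C) : C → Corona A A := E.self.busby

variable {E : AlgExtension A B C}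
  {V : Type u} [NormedAddCommGroup V] [NormedSpace ℂ V] [SMul A V] [CStarModule A V]
  {Z : Type u} [NormedAddCommGroup Z] [NormedSpace ℂ Z] [SMul C Z] [CStarModule C Z]

/-- `Δ : Z → Q(V)` is a morphism of Hilbert `C⋆`-modules over `δ : C → Q(A)`. -/
def IsMorphism (E : AlgExtension A B C) (Δ : Z → Corona A V) : Prop :=
  ∀ z z' : Z, coronaInner (Δ z) (Δ z') = E.delta (inner C z z')

theorem Extension.isMorphism_busby (W : Extension E V Z) : IsMorphism E W.busby := by
  intro z z'
  obtain ⟨w, rfl⟩ := W.surjective z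
  obtain ⟨w', rfl⟩ := W.surjective z'
  rw [W.busby_Ψ, W.busby_Ψ, coronaInner_mk, W.inner_Ψ]
  refine Eq.trans ?_ (E.self.busby_Ψ (inner B w w')).symm
  congr 1
  refine Subtype.ext <| ContinuousLinearMap.ext fun a => E.injective ?_
  rw [multInner_apply, W.φ_adj_lam, W.Φ_lam, CStarModule.inner_op_smul_right]
  exact (E.self.Φ_lam (inner B w w') a).symm

/-- Two extensions are homotopic if their Busby invariants are joined by a path of morphisms
`Δ_t : Z → Q(V)`, `t ∈ [0, 1]`, such that `t ↦ Δ_t(z)` is norm continuous for every `z`. -/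
def Extension.Homotopic (W₀ W₁ : Extension E V Z) : Prop :=
  ∃ Δ : unitInterval → Z → Corona A V, (∀ t, IsMorphism E (Δ t)) ∧
    Δ 0 = W₀.busby ∧ Δ 1 = W₁.busby ∧ ∀ z, Continuous fun t => Δ t z

theorem Extension.homotopic_iff (W₀ W₁ : Extension E V Z) :
    W₀.Homotopic W₁ ↔ JoinedIn {Δ : Z → Corona A V | IsMorphism E Δ} W₀.busby W₁.busby := by
  constructor
  · rintro ⟨Δ, h, h0, h1, hc⟩
    exact ⟨⟨⟨Δ, continuous_pi hc⟩, h0, h1⟩, h⟩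
  · rintro ⟨γ, h⟩
    exact ⟨γ, h, γ.source, γ.target, fun z => (continuous_apply z).comp γ.continuous⟩

theorem Extension.homotopic_equivalence :
    Equivalence (Extension.Homotopic : Extension E V Z → Extension E V Z → Prop) where
  refl W := (W.homotopic_iff W).mpr (JoinedIn.refl W.isMorphism_busby)
  symm h := (homotopic_iff _ _).mpr ((homotopic_iff _ _).mp h).symm
  trans h h' := (homotopic_iff _ _).mpr
    (((homotopic_iff _ _).mp h).trans ((homotopic_iff _ _).mp h'))

variable (E V Z) in
/-- The homotopy classes of extensions `0 → V → W → Z → 0` over a `C⋆`-algebra extension. -/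
def HomotopyClasses : Type (u + 1) :=
  Quotient (⟨Extension.Homotopic, Extension.homotopic_equivalence⟩ : Setoid (Extension E V Z))

/-- The homotopy class of an extension. -/
def Extension.homotopyClass (W : Extension E V Z) : HomotopyClasses E V Z := Quotient.mk _ W

end Extension

/-! ### The commutative extension of an open dense subset -/

section Spaces

variable {X : Type u} [TopologicalSpace X]

/-- The order of the `C⋆`-algebra `C₀(X)`. -/
noncomputable instance : PartialOrder C₀(X, ℂ) := CStarAlgebra.spectralOrder _

instance : StarOrderedRing C₀(X, ℂ) := CStarAlgebra.spectralOrderedRing _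

/-- The multiplier of `C₀(X)` given by a bounded continuous function `g`: `a ↦ g a`. -/
noncomputable def boundedMult (g : BoundedContinuousFunction X ℂ) : Mult C₀(X, ℂ) C₀(X, ℂ) :=
  let m (g : BoundedContinuousFunction X ℂ) : C₀(X, ℂ) →L[ℂ] C₀(X, ℂ) := LinearMap.mkContinuous
    { toFun := fun a =>
        { toFun := fun x => g x * a x
          continuous_toFun := g.continuous.mul (map_continuous a)
          zero_at_infty' := by
            refine squeeze_zero_norm (a := fun x => ‖g‖ * ‖a x‖) (fun x => ?_) ?_
            · rw [norm_mul]
              exact mul_le_mul_of_nonneg_right (g.norm_coe_le_norm x) (norm_nonneg _)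
            · simpa using (zero_at_infty a).norm.const_mul ‖g‖ }
      map_add' := fun a b => by
        ext x
        exact mul_add _ _ _
      map_smul' := fun c a => by
        ext x
        exact mul_left_comm _ _ _ } ‖g‖ (fun a => by
          rw [← ZeroAtInftyContinuousMap.norm_toBCF_eq_norm,
            ← ZeroAtInftyContinuousMap.norm_toBCF_eq_norm]
          refine BoundedContinuousFunction.norm_le (by positivity) |>.mpr fun x => ?_
          refine (norm_mul_le _ _).trans ?_
          exact mul_le_mul (g.norm_coe_le_norm x) (a.toBCF.norm_coe_le_norm x)
            (norm_nonneg _) (norm_nonneg _))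
  ⟨m g, m (star g), fun a v => by
    ext x
    change v x * star (g x * a x) = star (g x) * v x * star (a x)
    rw [star_mul]
    ring⟩

theorem boundedMult_apply (g : BoundedContinuousFunction X ℂ) (a : C₀(X, ℂ)) (x : X) :
    (boundedMult g).1 a x = g x * a x := rfl

variable [CompactSpace X] [T2Space X] (U : TopologicalSpace.Opens X)

open Classical in
/-- Extension by zero `C₀(U) → C(X)`. -/
noncomputable def extendZero : C₀(U, ℂ) →⋆ₙₐ[ℂ] C(X, ℂ) where
  toFun f :=
    { toFun := fun x => if h : x ∈ U then f ⟨x, h⟩ else 0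
      continuous_toFun := by
        rw [continuous_iff_continuousAt]
        intro x
        by_cases hx : x ∈ U
        · have h : ContinuousOn (fun x => if h : x ∈ U then f ⟨x, h⟩ else 0) (U : Set X) := by
            rw [continuousOn_iff_continuous_domRestrict]
            refine (map_continuous f).congr fun y => ?_
            simp
          exact h.continuousAt (U.isOpen.mem_nhds hx)
        · unfold ContinuousAt
          simp only [hx, dite_false]
          rw [Metric.tendsto_nhds]
          intro ε hε
          have h := (Metric.tendsto_nhds.mp (zero_at_infty f)) ε hε
          obtain ⟨K, hK, hK'⟩ := Filter.mem_cocompact.mp h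
          have hc : IsClosed ((↑) '' K : Set X) := (hK.image continuous_subtype_val).isClosed
          have hxK : x ∈ ((↑) '' K : Set X)ᶜ := by
            rintro ⟨y, -, rfl⟩
            exact hx y.2
          filter_upwards [hc.isOpen_compl.mem_nhds hxK] with y hy
          by_cases hyU : y ∈ U
          · simp only [hyU, dite_true]
            exact hK' (fun hyK => hy ⟨⟨y, hyU⟩, hyK, rfl⟩)
          · simpa [hyU] using hε }
  map_smul' c f := by
    ext x
    by_cases h : x ∈ U <;> simp [h]
  map_zero' := by
    ext x
    simp
  map_add' f g := by
    ext x
    by_cases h : x ∈ U <;> simp [h]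
  map_mul' f g := by
    ext x
    by_cases h : x ∈ U <;> simp [h]
  map_star' f := by
    ext x
    by_cases h : x ∈ U <;> simp [h]

theorem extendZero_of_mem (f : C₀(U, ℂ)) (x : U) : extendZero U f x = f x := by
  simp [extendZero]

theorem extendZero_of_notMem (f : C₀(U, ℂ)) {x : X} (h : x ∉ U) : extendZero U f x = 0 := by
  simp [extendZero, h]

instance (s : Set X) : CompactSpace (frontier s) :=
  isCompact_iff_compactSpace.mp isClosed_frontier.isCompact

/-- The extension `0 → C₀(U) → C(X) → C(∂U) → 0` (extension by zero and restriction), for a dense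
open subset `U` of a compact Hausdorff space `X`. -/
noncomputable def openExtension (hU : Dense (U : Set X)) :
    AlgExtension C₀(U, ℂ) C(X, ℂ) C(frontier (U : Set X), ℂ) where
  φ := extendZero U
  π := ContinuousMap.compStarAlgHom' ℂ ℂ ⟨Subtype.val, continuous_subtype_val⟩
  injective f g h := by
    ext x
    rw [← extendZero_of_mem, h, extendZero_of_mem]
  surjective f := ContinuousMap.exists_restrict_eq isClosed_frontier f
  exact b := by
    have hf : ∀ x, x ∈ frontier (U : Set X) ↔ x ∉ U := fun x => by
      rw [U.isOpen.frontier_eq, hU.closure_eq]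
      simp
    constructor
    · intro h
      have hb : ∀ x, x ∉ U → b x = 0 := fun x hx =>
        DFunLike.congr_fun h ⟨x, (hf x).mpr hx⟩
      refine ⟨⟨⟨fun x : U => b x, b.continuous.comp continuous_subtype_val⟩, ?_⟩, ?_⟩
      · rw [Metric.tendsto_nhds]
        intro ε hε
        rw [Filter.Eventually, Filter.mem_cocompact]
        refine ⟨{x : U | ε ≤ ‖b x‖}, ?_, fun x hx => ?_⟩
        · rw [Subtype.isCompact_iff]
          have : ((↑) '' {x : U | ε ≤ ‖b x‖} : Set X) = {x | ε ≤ ‖b x‖} := by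
            ext x
            refine ⟨?_, fun hx => ?_⟩
            · rintro ⟨y, hy, rfl⟩
              exact hy
            · have hxU : x ∈ U := by
                by_contra hn
                have h0 : ε ≤ ‖b x‖ := hx
                rw [hb x hn, norm_zero] at h0
                exact absurd h0 (not_le.mpr hε)
              exact ⟨⟨x, hxU⟩, hx, rfl⟩
          rw [this]
          exact (isClosed_le continuous_const b.continuous.norm).isCompact
        · simpa using hx
      · ext x
        by_cases hx : x ∈ U
        · exact extendZero_of_mem U _ ⟨x, hx⟩
        · rw [hb x hx, extendZero_of_notMem U _ hx]
    · rintro ⟨a, rfl⟩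
      ext x
      exact extendZero_of_notMem U a ((hf x).mp x.2)

/-- The Stone–Čech corona `βY ∖ Y`. -/
abbrev StoneCechCorona (Y : Type u) [TopologicalSpace Y] : Type u :=
  {x : StoneCech Y // x ∉ Set.range (stoneCechUnit : Y → StoneCech Y)}

/-- `u : βU ∖ U → S¹` corresponds to `q ∈ Q(C₀(U))` under the canonical isomorphism
`Q(C₀(U)) = C(βU ∖ U)`: some `g ∈ C(βU)` restricts to `u` on `βU ∖ U`, and `q` is the class of the
multiplication by `g` on `C₀(U)`. -/
def Represents (u : C(StoneCechCorona U, Circle)) (q : Corona C₀(U, ℂ) C₀(U, ℂ)) : Prop :=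
  ∃ g : C(StoneCech U, ℂ), (∀ x : StoneCechCorona U, g x = u x) ∧
    q = toCorona (boundedMult
      ((BoundedContinuousFunction.mkOfCompact g).compContinuous
        ⟨stoneCechUnit, continuous_stoneCechUnit⟩))

/-- The set `[X, Y]` of homotopy classes of continuous maps. -/
abbrev MapClasses (X Y : Type*) [TopologicalSpace X] [TopologicalSpace Y] : Type _ :=
  Quotient (⟨ContinuousMap.Homotopic, ContinuousMap.Homotopic.equivalence⟩ : Setoid C(X, Y))

/-- The class in `[X, Y]` of a continuous map. -/
def mapClass {X Y : Type*} [TopologicalSpace X] [TopologicalSpace Y] (f : C(X, Y)) :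
    MapClasses X Y := Quotient.mk _ f

end Spaces

end HilbertExt

/-! The inclusion of `U` extends to a surjection `βU → X` that is injective over `U` and carries the
corona `βU ∖ U` onto `∂U`; call the map of coronas `q`. Multipliers of `C₀(U)` are functions on
`βU`, and those coming from `C₀(U)` itself are the functions vanishing on the corona. So a class in
`Q(C₀(U))` is determined by its `symbol`, a function on `βU ∖ U`. In these terms the inner product
is `f̄ g` and `δ` is composition with `q`.

A morphism `Δ` over `δ` therefore satisfies `conj (σ(Δ z)) · σ(Δ z') = (z' z̄) ∘ q`, with `σ` the
symbol. Taking `z = z' = 1` shows that `u = σ(Δ 1)` is unimodular, and taking `z = 1` gives `σ(Δ z')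
= u · (z' ∘ q)`. Hence morphisms amount to maps `u : βU ∖ U → S¹` (`isMorphism_iff`).

Paths of morphisms match homotopies of maps. Evaluation at `z = 1` turns a path into a homotopy,
because the symbol is norm-decreasing. Conversely, a homotopy extends by Tietze to `[0,1] × βU`, and
its curried form is a norm-continuous path of multipliers (`IsSymbol.homotopic_of_homotopic`,
`IsSymbol.homotopic`).

Every `u` occurs. Extend it to `g` on `βU` and let `W` consist of those `f` for which `ḡ f` descends
to `X`, with `Ψ` the restriction of `ḡ f` to the boundary (`twistedExtension`). Two extensions need
not be compared as modules, since homotopy only involves their Busby invariants. -/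

namespace HilbertExt

/-! ### The projection `βU → X` and its fibres -/

section StoneCechProjection

variable {X : Type u} [TopologicalSpace X] [CompactSpace X] [T2Space X]
  (U : TopologicalSpace.Opens X)

theorem mem_frontier_iff_notMem {U : TopologicalSpace.Opens X} (hU : Dense (U : Set X)) {x : X} :
    x ∈ frontier (U : Set X) ↔ x ∉ U := by
  rw [U.isOpen.frontier_eq, hU.closure_eq]
  simp

/-- The continuous extension `βU → X` of the inclusion `U → X`. -/
noncomputable def stoneCechProj : C(StoneCech U, X) :=
  ⟨stoneCechExtend (continuous_subtype_val (p := (· ∈ U))), continuous_stoneCechExtend _⟩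

@[simp]
theorem stoneCechProj_unit (x : U) : stoneCechProj U (stoneCechUnit x) = x :=
  stoneCechExtend_stoneCechUnit (continuous_subtype_val (p := (· ∈ U))) x

/-- This is where local compactness of `U` enters. A point over `U` lies over the interior of a
compact `K ⊆ U`. By density it is a limit of points of `K`, and the image of `K` in `βU` is closed.
-/
theorem stoneCechProj_mem_iff (p : StoneCech U) :
    stoneCechProj U p ∈ U ↔ p ∈ Set.range (stoneCechUnit : U → StoneCech U) := by
  refine ⟨fun hp => ?_, ?_⟩
  · obtain ⟨K, hK, hpK, hKU⟩ := exists_compact_subset U.isOpen hp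
    have hL : IsCompact ((↑) ⁻¹' K : Set U) := by
      rw [Subtype.isCompact_iff]
      exact (Subtype.image_preimage_coe (U : Set X) K ▸ (Set.inter_eq_right.mpr hKU).symm ▸ hK)
    have hc : IsClosed ((stoneCechUnit : U → StoneCech U) '' ((↑) ⁻¹' K)) :=
      (hL.image continuous_stoneCechUnit).isClosed
    have hO : IsOpen (stoneCechProj U ⁻¹' interior K) :=
      isOpen_interior.preimage (stoneCechProj U).continuous
    have h : p ∈ closure (stoneCechProj U ⁻¹' interior K ∩
        Set.range (stoneCechUnit : U → StoneCech U)) :=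
      denseRange_stoneCechUnit.open_subset_closure_inter hO hpK
    have h' : p ∈ (stoneCechUnit : U → StoneCech U) '' ((↑) ⁻¹' K) := by
      refine closure_minimal ?_ hc h
      rintro _ ⟨hx, x, rfl⟩
      refine ⟨x, ?_, rfl⟩
      have := interior_subset hx
      rwa [stoneCechProj_unit] at this
    exact Set.image_subset_range _ _ h'
  · rintro ⟨x, rfl⟩
    rw [stoneCechProj_unit]
    exact x.2

theorem isClosed_stoneCechCorona :
    IsClosed {p : StoneCech U | p ∉ Set.range (stoneCechUnit : U → StoneCech U)} := by
  simp only [← stoneCechProj_mem_iff]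
  exact (U.isOpen.preimage (stoneCechProj U).continuous).isClosed_compl

instance : CompactSpace (StoneCechCorona U) :=
  isCompact_iff_compactSpace.mp (isClosed_stoneCechCorona U).isCompact

/-- Fibres over `U` are single points, so constancy on fibres only has to be checked on the corona.
-/
theorem stoneCechProj_eq_iff {p q : StoneCech U} (h : stoneCechProj U p = stoneCechProj U q) :
    p = q ∨ (p ∉ Set.range (stoneCechUnit : U → StoneCech U) ∧
      q ∉ Set.range (stoneCechUnit : U → StoneCech U)) := by
  by_cases hp : stoneCechProj U p ∈ U
  · left
    have hq := h ▸ hp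
    obtain ⟨x, rfl⟩ := (stoneCechProj_mem_iff U p).mp hp
    obtain ⟨y, rfl⟩ := (stoneCechProj_mem_iff U q).mp hq
    rw [stoneCechProj_unit, stoneCechProj_unit] at h
    rw [Subtype.ext h]
  · right
    have hq := h ▸ hp
    rw [stoneCechProj_mem_iff] at hp hq
    exact ⟨hp, hq⟩

theorem stoneCechProj_surjective {U : TopologicalSpace.Opens X} (hU : Dense (U : Set X)) :
    Function.Surjective (stoneCechProj U) := by
  have hc : IsClosed (Set.range (stoneCechProj U)) :=
    (isCompact_range (stoneCechProj U).continuous).isClosed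
  have hd : (U : Set X) ⊆ Set.range (stoneCechProj U) := fun x hx =>
    ⟨stoneCechUnit ⟨x, hx⟩, stoneCechProj_unit U ⟨x, hx⟩⟩
  intro x
  exact closure_minimal hd hc (hU x)

theorem isQuotientMap_stoneCechProj {U : TopologicalSpace.Opens X} (hU : Dense (U : Set X)) :
    Topology.IsQuotientMap (stoneCechProj U) :=
  (stoneCechProj U).continuous.isClosedMap.isQuotientMap (stoneCechProj U).continuous
    (stoneCechProj_surjective hU)

/-- The map `βU ∖ U → ∂U` induced by `βU → X`. -/
noncomputable def coronaProj {U : TopologicalSpace.Opens X} (hU : Dense (U : Set X)) :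
    C(StoneCechCorona U, frontier (U : Set X)) where
  toFun p := ⟨stoneCechProj U p, (mem_frontier_iff_notMem hU).mpr fun h =>
    p.2 ((stoneCechProj_mem_iff U p).mp h)⟩
  continuous_toFun := by fun_prop

theorem coronaProj_surjective {U : TopologicalSpace.Opens X} (hU : Dense (U : Set X)) :
    Function.Surjective (coronaProj hU) := by
  rintro ⟨x, hx⟩
  obtain ⟨p, rfl⟩ := stoneCechProj_surjective hU x
  exact ⟨⟨p, fun hp => (mem_frontier_iff_notMem hU).mp hx
    ((stoneCechProj_mem_iff U p).mpr hp)⟩, rfl⟩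

theorem isQuotientMap_coronaProj {U : TopologicalSpace.Opens X} (hU : Dense (U : Set X)) :
    Topology.IsQuotientMap (coronaProj hU) :=
  (coronaProj hU).continuous.isClosedMap.isQuotientMap (coronaProj hU).continuous
    (coronaProj_surjective hU)

/-- A function on `βU` vanishing on the corona comes from `C₀(U)`. -/
theorem exists_extendZero_eq {U : TopologicalSpace.Opens X} (hU : Dense (U : Set X))
    (f : C(StoneCech U, ℂ)) (hf : ∀ p : StoneCechCorona U, f p = 0) :
    ∃ a : C₀(U, ℂ), ∀ p, extendZero U a (stoneCechProj U p) = f p := by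
  have hfib : ∀ p q, stoneCechProj U p = stoneCechProj U q → f p = f q := fun p q h => by
    obtain rfl | ⟨hp, hq⟩ := stoneCechProj_eq_iff U h
    · rfl
    · rw [hf ⟨p, hp⟩, hf ⟨q, hq⟩]
  let b : C(X, ℂ) := (isQuotientMap_stoneCechProj hU).lift f hfib
  have hb : ∀ p, b (stoneCechProj U p) = f p := fun p =>
    DFunLike.congr_fun ((isQuotientMap_stoneCechProj hU).lift_comp f hfib) p
  obtain ⟨a, ha⟩ := ((openExtension U hU).exact b).mp <| by
    ext x
    obtain ⟨p, rfl⟩ := coronaProj_surjective hU x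
    exact (hb p).trans (hf p)
  exact ⟨a, fun p => (DFunLike.congr_fun ha _).trans (hb p)⟩

theorem extendZero_stoneCechProj_corona (a : C₀(U, ℂ)) (p : StoneCechCorona U) :
    extendZero U a (stoneCechProj U p) = 0 :=
  extendZero_of_notMem U a fun h => p.2 ((stoneCechProj_mem_iff U p).mp h)

end StoneCechProjection

/-! ### The multiplier algebra of `C₀(U)` as `C(βU)` -/

section MultiplierAlgebra

variable {A : Type u} [NonUnitalCommCStarAlgebra A] [PartialOrder A] [StarOrderedRing A]

theorem mult_map_mul (T : Mult A A) (a b : A) : T.1 (a * b) = a * T.1 b := by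
  refine inner_ext (A := A) fun v => ?_
  rw [adj_spec', ← smul_eq_mul a b, CStarModule.inner_op_smul_right, ← adj_spec',
    ← smul_eq_mul a (T.1 b), CStarModule.inner_op_smul_right]

/-- Both sides are `T (a b)`. For functions this says that the ratio `T a / a` does not depend on
`a`, which exhibits `T` as a multiplication operator. -/
theorem mult_mul_map_comm (T : Mult A A) (a b : A) : a * T.1 b = b * T.1 a := by
  rw [← mult_map_mul, mul_comm, mult_map_mul]

variable {X : Type u} [TopologicalSpace X] [CompactSpace X] [T2Space X]
  {U : TopologicalSpace.Opens X}

/-- Urysohn bumps replace the missing unit: applied to a bump at `x`, a multiplier reveals its value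
at `x`, with control by the operator norm. -/
theorem exists_norm_le_one_apply_eq_one (hU : Dense (U : Set X)) (x : U) :
    ∃ e : C₀(U, ℂ), ‖e‖ ≤ 1 ∧ e x = 1 := by
  obtain ⟨f, h0, h1, hf⟩ := exists_continuous_zero_one_of_isClosed U.isOpen.isClosed_compl
    (isClosed_singleton (x := (x : X))) (Set.disjoint_singleton_right.mpr fun h => h x.2)
  let b : C(X, ℂ) := ⟨fun y => (f y : ℂ), by fun_prop⟩
  obtain ⟨a, ha⟩ := ((openExtension U hU).exact b).mp <| by
    ext y
    have : f y = 0 := h0 ((mem_frontier_iff_notMem hU).mp y.2)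
    change ((f y : ℝ) : ℂ) = 0
    simp [this]
  have hab : ∀ y : U, a y = f y := fun y =>
    (extendZero_of_mem U a y).symm.trans (DFunLike.congr_fun ha (y : X))
  refine ⟨a, ?_, ?_⟩
  · rw [← ZeroAtInftyContinuousMap.norm_toBCF_eq_norm]
    refine (BoundedContinuousFunction.norm_le zero_le_one).mpr fun y => ?_
    change ‖a y‖ ≤ 1
    rw [hab, Complex.norm_real, Real.norm_eq_abs, abs_of_nonneg (hf _).1]
    exact (hf _).2
  · rw [hab, h1 rfl]
    simp

theorem norm_apply_le (a : C₀(U, ℂ)) (x : U) : ‖a x‖ ≤ ‖a‖ := by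
  rw [← ZeroAtInftyContinuousMap.norm_toBCF_eq_norm]
  exact a.toBCF.norm_coe_le_norm x

theorem exists_boundedMult_eq (hU : Dense (U : Set X)) (T : Mult C₀(U, ℂ) C₀(U, ℂ)) :
    ∃ g : BoundedContinuousFunction U ℂ, boundedMult g = T := by
  choose e he he1 using exists_norm_le_one_apply_eq_one hU
  have key : ∀ (a b : C₀(U, ℂ)) (y : U), a y * T.1 b y = b y * T.1 a y := fun a b y =>
    DFunLike.congr_fun (mult_mul_map_comm T a b) y
  have hT : ∀ a x, T.1 (e x) x * a x = T.1 a x := fun a x => by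
    rw [mul_comm, key, he1, one_mul]
  refine ⟨BoundedContinuousFunction.ofNormedAddCommGroup (fun x => T.1 (e x) x) ?_ ‖T.1‖ ?_, ?_⟩
  · rw [continuous_iff_continuousAt]
    intro x
    have hx : e x x ≠ 0 := by rw [he1]; exact one_ne_zero
    -- The bump in `T (e y) y` varies with `y`, so continuity is proved by comparison with the
    -- quotient for the fixed bump `e x`, valid wherever `e x` does not vanish.
    have hc : ContinuousAt (fun y => T.1 (e x) y / e x y) x :=
      (map_continuous (T.1 (e x))).continuousAt.div (map_continuous (e x)).continuousAt hx
    refine hc.congr ?_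
    filter_upwards [(map_continuous (e x)).continuousAt.eventually_ne hx] with y hy
    rw [← hT (e x) y, mul_div_cancel_right₀ _ hy]
  · intro x
    refine (norm_apply_le _ x).trans ((T.1.le_opNorm _).trans ?_)
    exact mul_le_of_le_one_right (norm_nonneg _) (he x)
  · exact Subtype.ext <| ContinuousLinearMap.ext fun a => ZeroAtInftyContinuousMap.ext fun x =>
      hT a x

theorem norm_le_norm_boundedMult (hU : Dense (U : Set X)) (g : BoundedContinuousFunction U ℂ) :
    ‖g‖ ≤ ‖boundedMult g‖ := by
  refine (BoundedContinuousFunction.norm_le (norm_nonneg _)).mpr fun x => ?_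
  obtain ⟨e, he, he1⟩ := exists_norm_le_one_apply_eq_one hU x
  calc ‖g x‖ = ‖(boundedMult g).1 e x‖ := by rw [boundedMult_apply, he1, mul_one]
    _ ≤ ‖(boundedMult g).1 e‖ := norm_apply_le _ x
    _ ≤ ‖(boundedMult g).1‖ * ‖e‖ := ContinuousLinearMap.le_opNorm _ _
    _ ≤ _ := mul_le_of_le_one_right (norm_nonneg _) he

variable (U) in
/-- A continuous function `g` on `βU`, as a multiplier of `C₀(U)`. -/
noncomputable def stoneCechMult : C(StoneCech U, ℂ) →ₗ[ℂ] Mult C₀(U, ℂ) C₀(U, ℂ) where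
  toFun g := boundedMult ((BoundedContinuousFunction.mkOfCompact g).compContinuous
    ⟨stoneCechUnit, continuous_stoneCechUnit⟩)
  map_add' f g := Subtype.ext <| ContinuousLinearMap.ext fun a =>
    ZeroAtInftyContinuousMap.ext fun x => add_mul (f (stoneCechUnit x)) (g (stoneCechUnit x)) (a x)
  map_smul' c g := Subtype.ext <| ContinuousLinearMap.ext fun a =>
    ZeroAtInftyContinuousMap.ext fun x => mul_assoc c (g (stoneCechUnit x)) (a x)

theorem stoneCechMult_apply (g : C(StoneCech U, ℂ)) (a : C₀(U, ℂ)) (x : U) :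
    (stoneCechMult U g).1 a x = g (stoneCechUnit x) * a x := rfl

/-- Bumps bound `g` on `U`, and density of `U` in `βU` does the rest. This gives injectivity and,
later, the norm bound for the symbol. -/
theorem norm_stoneCechMult (hU : Dense (U : Set X)) (g : C(StoneCech U, ℂ)) :
    ‖g‖ ≤ ‖stoneCechMult U g‖ := by
  refine le_trans ?_ (norm_le_norm_boundedMult hU _)
  refine (ContinuousMap.norm_le _ (norm_nonneg _)).mpr fun p => ?_
  refine denseRange_stoneCechUnit.induction_on (p := fun p => ‖g p‖ ≤ _) p
    (isClosed_le (by fun_prop) continuous_const) fun x => ?_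
  exact BoundedContinuousFunction.norm_coe_le_norm ((BoundedContinuousFunction.mkOfCompact
    g).compContinuous ⟨stoneCechUnit, continuous_stoneCechUnit⟩) x

theorem norm_stoneCechMult_le (g : C(StoneCech U, ℂ)) : ‖stoneCechMult U g‖ ≤ ‖g‖ := by
  refine ContinuousLinearMap.opNorm_le_bound _ (norm_nonneg _) fun a => ?_
  rw [← ZeroAtInftyContinuousMap.norm_toBCF_eq_norm]
  refine (BoundedContinuousFunction.norm_le (by positivity)).mpr fun x => ?_
  change ‖g (stoneCechUnit x) * a x‖ ≤ _
  rw [norm_mul]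
  exact mul_le_mul (g.norm_coe_le_norm _) (norm_apply_le a x) (norm_nonneg _) (norm_nonneg _)

theorem continuous_stoneCechMult : Continuous (stoneCechMult U) :=
  AddMonoidHomClass.continuous_of_bound (stoneCechMult U) 1 fun g => by
    rw [one_mul]
    exact norm_stoneCechMult_le g

theorem stoneCechMult_injective (hU : Dense (U : Set X)) :
    Function.Injective (stoneCechMult U) := by
  refine (injective_iff_map_eq_zero _).mpr fun g hg => norm_le_zero_iff.mp ?_
  refine (norm_stoneCechMult hU g).trans_eq ?_
  rw [hg, norm_zero]

theorem stoneCechMult_surjective (hU : Dense (U : Set X)) :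
    Function.Surjective (stoneCechMult U) := by
  intro T
  obtain ⟨g, rfl⟩ := exists_boundedMult_eq hU T
  -- The universal property of `βU` needs a compact target, and boundedness of `g` supplies this
  -- ball.
  let f : U → Metric.closedBall (0 : ℂ) ‖g‖ := fun x =>
    ⟨g x, mem_closedBall_zero_iff.mpr (g.norm_coe_le_norm x)⟩
  have hf : Continuous f := g.continuous.subtype_mk _
  refine ⟨⟨fun p => (stoneCechExtend hf p : Metric.closedBall (0 : ℂ) ‖g‖),
    continuous_subtype_val.comp (continuous_stoneCechExtend hf)⟩, ?_⟩
  refine Subtype.ext <| ContinuousLinearMap.ext fun a => ZeroAtInftyContinuousMap.ext fun x => ?_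
  rw [stoneCechMult_apply, boundedMult_apply]
  change ((stoneCechExtend hf (stoneCechUnit x) : Metric.closedBall (0 : ℂ) ‖g‖) : ℂ) * a x = _
  rw [stoneCechExtend_stoneCechUnit]

/-- The multiplier algebra of `C₀(U)` is `C(βU)`. -/
noncomputable def stoneCechMultEquiv (hU : Dense (U : Set X)) :
    C(StoneCech U, ℂ) ≃ₗ[ℂ] Mult C₀(U, ℂ) C₀(U, ℂ) :=
  LinearEquiv.ofBijective (stoneCechMult U)
    ⟨stoneCechMult_injective hU, stoneCechMult_surjective hU⟩

theorem stoneCechMultEquiv_symm_stoneCechMult (hU : Dense (U : Set X)) (g : C(StoneCech U, ℂ)) :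
    (stoneCechMultEquiv hU).symm (stoneCechMult U g) = g :=
  (stoneCechMultEquiv hU).symm_apply_apply g

/-- The function on `βU` attached to `a` vanishes on the corona, which makes the symbol well defined
on the quotient. -/
theorem Gam_eq_stoneCechMult (a : C₀(U, ℂ)) :
    Gam (A := C₀(U, ℂ)) a = stoneCechMult U ((extendZero U a).comp (stoneCechProj U)) := by
  refine Subtype.ext <| ContinuousLinearMap.ext fun b => ZeroAtInftyContinuousMap.ext fun x => ?_
  rw [stoneCechMult_apply, ContinuousMap.comp_apply, stoneCechProj_unit, extendZero_of_mem]
  exact mul_comm (b x) (a x)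

theorem multInner_stoneCechMult (f g : C(StoneCech U, ℂ)) :
    multInner (stoneCechMult U f) (stoneCechMult U g) = stoneCechMult U (star f * g) := by
  refine Subtype.ext <| ContinuousLinearMap.ext fun b => ?_
  rw [multInner_apply, adj_unique (stoneCechMult U f) (stoneCechMult U (star f)).1]
  · refine ZeroAtInftyContinuousMap.ext fun x => ?_
    simp only [stoneCechMult_apply, ContinuousMap.mul_apply, mul_assoc]
  · intro a v
    refine ZeroAtInftyContinuousMap.ext fun x => ?_
    change v x * star (f (stoneCechUnit x) * a x) = star (f (stoneCechUnit x)) * v x * star (a x)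
    rw [star_mul]
    ring

end MultiplierAlgebra

/-! ### Symbols: corona classes as functions on `βU ∖ U` -/

section Symbol

variable {X : Type u} [TopologicalSpace X] [CompactSpace X] [T2Space X]
  {U : TopologicalSpace.Opens X}

variable (U) in
/-- The restriction map `C(βU) → C(βU ∖ U)`. -/
noncomputable def restrictCorona : C(StoneCech U, ℂ) →ₗ[ℂ] C(StoneCechCorona U, ℂ) where
  toFun g := g.comp ⟨Subtype.val, continuous_subtype_val⟩
  map_add' _ _ := rfl
  map_smul' _ _ := rfl

theorem restrictCorona_apply (g : C(StoneCech U, ℂ)) (p : StoneCechCorona U) :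
    restrictCorona U g p = g p := rfl

/-- The canonical map `Q(C₀(U)) → C(βU ∖ U)`. -/
noncomputable def symbol (hU : Dense (U : Set X)) :
    Corona C₀(U, ℂ) C₀(U, ℂ) →ₗ[ℂ] C(StoneCechCorona U, ℂ) :=
  (LinearMap.range (Gam (A := C₀(U, ℂ)) (V := C₀(U, ℂ)))).liftQ
    (restrictCorona U ∘ₗ (stoneCechMultEquiv hU).symm.toLinearMap) <| by
      rintro _ ⟨a, rfl⟩
      rw [LinearMap.mem_ker, Gam_eq_stoneCechMult]
      ext p
      change (stoneCechMultEquiv hU).symm (stoneCechMult U _) p = 0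
      rw [stoneCechMultEquiv_symm_stoneCechMult]
      exact extendZero_stoneCechProj_corona U a p

theorem symbol_stoneCechMult (hU : Dense (U : Set X)) (g : C(StoneCech U, ℂ)) :
    symbol hU (toCorona (stoneCechMult U g)) = restrictCorona U g := by
  change restrictCorona U ((stoneCechMultEquiv hU).symm (stoneCechMult U g)) = _
  rw [stoneCechMultEquiv_symm_stoneCechMult]

theorem exists_toCorona_stoneCechMult (hU : Dense (U : Set X))
    (q : Corona C₀(U, ℂ) C₀(U, ℂ)) : ∃ g, toCorona (stoneCechMult U g) = q := by
  obtain ⟨T, rfl⟩ := Submodule.Quotient.mk_surjective _ q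
  obtain ⟨g, rfl⟩ := stoneCechMult_surjective hU T
  exact ⟨g, rfl⟩

/-- Choose a lift whose norm nearly attains the quotient norm; restriction to the corona cannot
increase the supremum. -/
theorem norm_symbol_le (hU : Dense (U : Set X)) (q : Corona C₀(U, ℂ) C₀(U, ℂ)) :
    ‖symbol hU q‖ ≤ ‖q‖ := by
  refine le_of_forall_pos_le_add fun ε hε => ?_
  obtain ⟨T, rfl, hT⟩ := Submodule.Quotient.norm_mk_lt q hε
  obtain ⟨g, rfl⟩ := stoneCechMult_surjective hU T
  refine le_trans ?_ hT.le
  refine le_trans ?_ (norm_stoneCechMult hU g)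
  change ‖symbol hU (toCorona (stoneCechMult U g))‖ ≤ _
  rw [symbol_stoneCechMult]
  exact (ContinuousMap.norm_le _ (norm_nonneg _)).mpr fun p => g.norm_coe_le_norm p

theorem continuous_symbol (hU : Dense (U : Set X)) : Continuous (symbol hU) :=
  AddMonoidHomClass.continuous_of_bound (symbol hU) 1 fun q => by
    rw [one_mul]
    exact norm_symbol_le hU q

theorem symbol_injective (hU : Dense (U : Set X)) : Function.Injective (symbol hU) := by
  refine (injective_iff_map_eq_zero _).mpr fun q hq => ?_
  obtain ⟨g, rfl⟩ := exists_toCorona_stoneCechMult hU q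
  rw [symbol_stoneCechMult] at hq
  obtain ⟨a, ha⟩ := exists_extendZero_eq hU g fun p => DFunLike.congr_fun hq p
  refine (Submodule.Quotient.mk_eq_zero _).mpr ⟨a, ?_⟩
  rw [Gam_eq_stoneCechMult]
  congr 1
  ext p
  exact ha p

theorem symbol_coronaInner (hU : Dense (U : Set X)) (p q : Corona C₀(U, ℂ) C₀(U, ℂ)) :
    symbol hU (coronaInner p q) = star (symbol hU p) * symbol hU q := by
  obtain ⟨f, rfl⟩ := exists_toCorona_stoneCechMult hU p
  obtain ⟨g, rfl⟩ := exists_toCorona_stoneCechMult hU q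
  rw [coronaInner_mk, multInner_stoneCechMult]
  simp only [symbol_stoneCechMult]
  rfl

/-- A lift `b ∈ C(X)` of `c` acts on `C₀(U)` as multiplication by its pullback to `βU`, whose
restriction to the corona only sees `c`. -/
theorem symbol_delta (hU : Dense (U : Set X)) (c : C(frontier (U : Set X), ℂ)) :
    symbol hU ((openExtension U hU).delta c) = c.comp (coronaProj hU) := by
  obtain ⟨b, rfl⟩ := (openExtension U hU).surjective c
  have h : (openExtension U hU).self.lam b = stoneCechMult U (b.comp (stoneCechProj U)) := by
    refine Subtype.ext <| ContinuousLinearMap.ext fun a => ZeroAtInftyContinuousMap.ext fun x => ?_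
    rw [stoneCechMult_apply, ContinuousMap.comp_apply, stoneCechProj_unit, ← extendZero_of_mem,
      ← extendZero_of_mem U a, mul_comm]
    have h0 : extendZero U (((openExtension U hU).self.lam b).1 a) = extendZero U a * b :=
      (openExtension U hU).self.Φ_lam b a
    exact DFunLike.congr_fun h0 (x : X)
  have h' : (openExtension U hU).delta ((openExtension U hU).π b) =
      toCorona ((openExtension U hU).self.lam b) := (openExtension U hU).self.busby_Ψ b
  rw [h', h, symbol_stoneCechMult]
  rfl

theorem represents_iff (hU : Dense (U : Set X)) (u : C(StoneCechCorona U, Circle))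
    (q : Corona C₀(U, ℂ) C₀(U, ℂ)) : Represents U u q ↔ ∀ p, symbol hU q p = u p := by
  constructor
  · rintro ⟨g, hg, rfl⟩ p
    rw [← hg]
    exact DFunLike.congr_fun (symbol_stoneCechMult hU g) p
  · intro h
    obtain ⟨g, rfl⟩ := exists_toCorona_stoneCechMult hU q
    refine ⟨g, fun p => ?_, rfl⟩
    rw [← h, symbol_stoneCechMult, restrictCorona_apply]

/-- The morphisms `C(∂U) → Q(C₀(U))` are given by multiplication by functions `βU ∖ U → S¹`. -/
theorem isMorphism_iff (hU : Dense (U : Set X))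
    (Δ : C(frontier (U : Set X), ℂ) → Corona C₀(U, ℂ) C₀(U, ℂ)) :
    IsMorphism (openExtension U hU) Δ ↔ ∃ u : C(StoneCechCorona U, Circle),
      ∀ z p, symbol hU (Δ z) p = u p * z (coronaProj hU p) := by
  have key : IsMorphism (openExtension U hU) Δ ↔ ∀ z z' p,
      star (symbol hU (Δ z) p) * symbol hU (Δ z') p =
        z' (coronaProj hU p) * star (z (coronaProj hU p)) := by
    refine forall₂_congr fun z z' => ?_
    rw [← (symbol_injective hU).eq_iff, symbol_coronaInner, symbol_delta, DFunLike.ext_iff]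
    rfl
  rw [key]
  constructor
  · intro h
    -- The pair `(1, 1)` makes the symbol of `Δ 1` unimodular; the pair `(1, z)` below then
    -- determines `Δ z`.
    have h1 : ∀ p, symbol hU (Δ 1) p * star (symbol hU (Δ 1) p) = 1 := fun p => by
      rw [mul_comm]
      simpa using h 1 1 p
    refine ⟨⟨fun p => ⟨symbol hU (Δ 1) p, ?_⟩, ?_⟩, fun z p => ?_⟩
    · refine mem_sphere_zero_iff_norm.mpr ?_
      rw [← sq_eq_sq₀ (norm_nonneg _) zero_le_one, ← Complex.ofReal_inj]
      have := h1 p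
      rw [Complex.star_def, Complex.mul_conj, Complex.normSq_eq_norm_sq] at this
      simpa using this
    · exact (symbol hU (Δ 1)).continuous.subtype_mk _
    · have h2 := h 1 z p
      simp only [ContinuousMap.one_apply, star_one, mul_one] at h2
      change _ = symbol hU (Δ 1) p * _
      rw [← h2, ← mul_assoc, h1, one_mul]
  · rintro ⟨u, hu⟩ z z' p
    have h1 : star (u p : ℂ) * u p = 1 := by
      rw [Complex.star_def, mul_comm, Complex.mul_conj, Circle.normSq_coe, Complex.ofReal_one]
    rw [hu, hu, star_mul]
    linear_combination z' (coronaProj hU p) * star (z (coronaProj hU p)) * h1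

/-! ### Homotopies of extensions and homotopies of symbols -/

/-- The function `u : βU ∖ U → S¹` describes the Busby invariant `z ↦ u z` of `W`. -/
def IsSymbol (hU : Dense (U : Set X))
    (W : Extension (openExtension U hU) C₀(U, ℂ) C(frontier (U : Set X), ℂ))
    (u : C(StoneCechCorona U, Circle)) : Prop :=
  ∀ z p, symbol hU (W.busby z) p = u p * z (coronaProj hU p)

variable {hU : Dense (U : Set X)}
  {W W₀ W₁ : Extension (openExtension U hU) C₀(U, ℂ) C(frontier (U : Set X), ℂ)}
  {u u₀ u₁ : C(StoneCechCorona U, Circle)}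

theorem exists_isSymbol (W : Extension (openExtension U hU) C₀(U, ℂ) C(frontier (U : Set X), ℂ)) :
    ∃ u, IsSymbol hU W u :=
  (isMorphism_iff hU W.busby).mp W.isMorphism_busby

theorem IsSymbol.represents (h : IsSymbol hU W u) : Represents U u (W.busby 1) :=
  (represents_iff hU u _).mpr fun p => by rw [h, ContinuousMap.one_apply, mul_one]

theorem continuous_toCorona_stoneCechMult :
    Continuous fun g => toCorona (stoneCechMult U g) :=
  continuous_quot_mk.comp continuous_stoneCechMult

theorem IsSymbol.homotopic_of_homotopic (h₀ : IsSymbol hU W₀ u₀) (h₁ : IsSymbol hU W₁ u₁)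
    (h : W₀.Homotopic W₁) : u₀.Homotopic u₁ := by
  obtain ⟨Δ, hΔ, hΔ0, hΔ1, hc⟩ := h
  choose v hv using fun t => (isMorphism_iff hU (Δ t)).mp (hΔ t)
  have hv' : ∀ t p, (v t p : ℂ) = symbol hU (Δ t 1) p := fun t p => by
    rw [hv, ContinuousMap.one_apply, mul_one]
  refine ⟨⟨⟨fun y => v y.1 y.2, ?_⟩, fun p => ?_, fun p => ?_⟩⟩
  · refine continuous_induced_rng.mpr ?_
    -- Continuity in the sup norm is what upgrades continuity in each variable to joint continuity.
    have : Continuous fun y : unitInterval × StoneCechCorona U => symbol hU (Δ y.1 1) y.2 :=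
      (((continuous_symbol hU).comp (hc 1)).comp continuous_fst).eval continuous_snd
    exact this.congr fun y => (hv' y.1 y.2).symm
  · refine Circle.ext ?_
    change (v 0 p : ℂ) = _
    rw [hv', hΔ0, h₀, ContinuousMap.one_apply, mul_one]
  · refine Circle.ext ?_
    change (v 1 p : ℂ) = _
    rw [hv', hΔ1, h₁, ContinuousMap.one_apply, mul_one]

/-- A path in the quotient is obtained by lifting to multipliers, so no bound of the quotient norm
by the symbol is needed. The lifted homotopy need not be unimodular off the corona. -/
theorem IsSymbol.homotopic (h₀ : IsSymbol hU W₀ u₀) (h₁ : IsSymbol hU W₁ u₁)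
    (h : u₀.Homotopic u₁) : W₀.Homotopic W₁ := by
  obtain ⟨H⟩ := h
  have he : Topology.IsClosedEmbedding
      (Prod.map id Subtype.val : unitInterval × StoneCechCorona U → unitInterval × StoneCech U) :=
    Topology.IsClosedEmbedding.id.prodMap (isClosed_stoneCechCorona U).isClosedEmbedding_subtypeVal
  obtain ⟨G, hG⟩ := ContinuousMap.exists_extension' he
    (⟨fun y => (H y : ℂ), by fun_prop⟩ : C(unitInterval × StoneCechCorona U, ℂ))
  have hG' : ∀ t (p : StoneCechCorona U), G (t, p) = H (t, p) := fun t p => congr_fun hG (t, p)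
  -- The lift of `z` to `C(X)` is fixed independently of `t`, so only the factor `G` varies along
  -- the path.
  choose b hb using (openExtension U hU).surjective
  have hb' : ∀ z (p : StoneCechCorona U), b z (stoneCechProj U p) = z (coronaProj hU p) :=
    fun z p => DFunLike.congr_fun (hb z) (coronaProj hU p)
  have hs : ∀ t z p, symbol hU (toCorona (stoneCechMult U
      (G.curry t * (b z).comp (stoneCechProj U)))) p = H (t, p) * z (coronaProj hU p) :=
    fun t z p => by
      rw [symbol_stoneCechMult, restrictCorona_apply, ContinuousMap.mul_apply,
        ContinuousMap.curry_apply, hG', ContinuousMap.comp_apply, hb']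
  refine ⟨fun t z => toCorona (stoneCechMult U (G.curry t * (b z).comp (stoneCechProj U))),
    fun t => ?_, funext fun z => symbol_injective hU ?_, funext fun z => symbol_injective hU ?_,
    fun z => ?_⟩
  · exact (isMorphism_iff hU _).mpr ⟨⟨fun p => H (t, p), by fun_prop⟩, hs t⟩
  · ext p
    rw [hs, h₀, H.apply_zero]
  · ext p
    rw [hs, h₁, H.apply_one]
  · exact continuous_toCorona_stoneCechMult.comp (G.curry.continuous.mul continuous_const)

end Symbol

/-! ### Realizing every map to the circle by an extension -/

section Realization

variable {X : Type u} [TopologicalSpace X] [CompactSpace X] [T2Space X]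
  {U : TopologicalSpace.Opens X}

/-- The function on `X` induced by a function on `βU` which is constant on the fibres of
`βU → X`. -/
noncomputable def descend (hU : Dense (U : Set X)) (f : C(StoneCech U, ℂ))
    (hf : ∀ p q, stoneCechProj U p = stoneCechProj U q → f p = f q) : C(X, ℂ) :=
  (isQuotientMap_stoneCechProj hU).lift f hf

@[simp]
theorem descend_stoneCechProj (hU : Dense (U : Set X)) (f : C(StoneCech U, ℂ))
    (hf : ∀ p q, stoneCechProj U p = stoneCechProj U q → f p = f q) (p : StoneCech U) :
    descend hU f hf (stoneCechProj U p) = f p :=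
  DFunLike.congr_fun ((isQuotientMap_stoneCechProj hU).lift_comp f hf) p

/-- Surjectivity of `βU → X` preserves suprema. Consequently the Hilbert module norm on
`twistedModule g` is the sup norm, for which completeness follows from closedness in `C(βU)`. -/
theorem norm_descend (hU : Dense (U : Set X)) (f : C(StoneCech U, ℂ))
    (hf : ∀ p q, stoneCechProj U p = stoneCechProj U q → f p = f q) :
    ‖descend hU f hf‖ = ‖f‖ := by
  refine le_antisymm ((ContinuousMap.norm_le _ (norm_nonneg _)).mpr fun x => ?_)
    ((ContinuousMap.norm_le _ (norm_nonneg _)).mpr fun p => ?_)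
  · obtain ⟨p, rfl⟩ := stoneCechProj_surjective hU x
    rw [descend_stoneCechProj]
    exact f.norm_coe_le_norm p
  · rw [← descend_stoneCechProj hU f hf]
    exact ContinuousMap.norm_coe_le_norm _ _

theorem ext_stoneCechProj (hU : Dense (U : Set X)) {b b' : C(X, ℂ)}
    (h : ∀ p, b (stoneCechProj U p) = b' (stoneCechProj U p)) : b = b' := by
  ext x
  obtain ⟨p, rfl⟩ := stoneCechProj_surjective hU x
  exact h p

/-- The functions `f` on `βU` such that `ḡ f` is constant on the fibres of `βU → X`. -/
noncomputable def twistedModule (g : C(StoneCech U, ℂ)) : Submodule ℂ C(StoneCech U, ℂ) where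
  carrier := {f | ∀ p q, stoneCechProj U p = stoneCechProj U q →
    star (g p) * f p = star (g q) * f q}
  add_mem' hf hf' p q h := by
    simp only [ContinuousMap.add_apply, mul_add, hf p q h, hf' p q h]
  zero_mem' p q _ := by simp
  smul_mem' c f hf p q h := by
    simp only [ContinuousMap.smul_apply, mul_smul_comm, hf p q h]

theorem isClosed_twistedModule (g : C(StoneCech U, ℂ)) :
    IsClosed (twistedModule g : Set C(StoneCech U, ℂ)) := by
  have : (twistedModule g : Set C(StoneCech U, ℂ)) = ⋂ (p) (q)
      (_ : stoneCechProj U p = stoneCechProj U q), {f | star (g p) * f p = star (g q) * f q} := by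
    ext f
    simp only [Set.mem_iInter]
    rfl
  rw [this]
  exact isClosed_iInter fun p => isClosed_iInter fun q => isClosed_iInter fun _ =>
    isClosed_eq (by fun_prop) (by fun_prop)

instance (g : C(StoneCech U, ℂ)) : CompleteSpace (twistedModule g) :=
  (isClosed_twistedModule g).completeSpace_coe

noncomputable instance (g : C(StoneCech U, ℂ)) : Module C(X, ℂ) (twistedModule g) where
  smul b f := ⟨b.comp (stoneCechProj U) * f.1, fun p q h => by
    simp only [ContinuousMap.mul_apply, ContinuousMap.comp_apply, h]
    rw [mul_left_comm, f.2 p q h, mul_left_comm]⟩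
  one_smul f := Subtype.ext <| ContinuousMap.ext fun p => one_mul (f.1 p)
  mul_smul b c f := Subtype.ext <| ContinuousMap.ext fun p => mul_assoc _ _ (f.1 p)
  smul_zero b := Subtype.ext <| ContinuousMap.ext fun p => mul_zero (b (stoneCechProj U p))
  smul_add b f f' := Subtype.ext <| ContinuousMap.ext fun p => mul_add _ (f.1 p) (f'.1 p)
  add_smul b c f := Subtype.ext <| ContinuousMap.ext fun p => add_mul _ _ (f.1 p)
  zero_smul f := Subtype.ext <| ContinuousMap.ext fun p => zero_mul (f.1 p)

theorem twistedModule_smul_apply {g : C(StoneCech U, ℂ)} (b : C(X, ℂ)) (f : twistedModule g)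
    (p : StoneCech U) : (b • f).1 p = b (stoneCechProj U p) * f.1 p := rfl

/-- On the corona `|g| = 1`, so `f' f̄` equals `(ḡ f')` times the conjugate of `ḡ f`, and both
factors are constant on fibres. -/
theorem twistedModule_mul_star {g : C(StoneCech U, ℂ)}
    (hg : ∀ p : StoneCechCorona U, g p * star (g p) = 1) (f f' : twistedModule g)
    (p q : StoneCech U) (h : stoneCechProj U p = stoneCechProj U q) :
    (f'.1 * star f.1) p = (f'.1 * star f.1) q := by
  obtain rfl | ⟨hp, hq⟩ := stoneCechProj_eq_iff U h
  · rfl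
  · have key : ∀ r : StoneCechCorona U, (f'.1 * star f.1) r =
        (star (g r) * f'.1 r) * star (star (g r) * f.1 r) := fun r => by
      simp only [ContinuousMap.mul_apply, ContinuousMap.star_apply, star_mul, star_star]
      linear_combination -(f'.1 r * star (f.1 r)) * hg r
    rw [key ⟨p, hp⟩, key ⟨q, hq⟩, f.2 p q h, f'.2 p q h]

/-- The `C(X)`-valued inner product `⟨f, f'⟩ = f' f̄` on `twistedModule g`. -/
@[reducible]
noncomputable def twistedCStarModule (hU : Dense (U : Set X)) {g : C(StoneCech U, ℂ)}
    (hg : ∀ p : StoneCechCorona U, g p * star (g p) = 1) :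
    CStarModule C(X, ℂ) (twistedModule g) where
  inner f f' := descend hU (f'.1 * star f.1) (twistedModule_mul_star hg f f')
  inner_add_right := ext_stoneCechProj hU fun p => by simp [add_mul]
  inner_self_nonneg {f} := ContinuousMap.le_def.mpr fun x => by
    obtain ⟨p, rfl⟩ := stoneCechProj_surjective hU x
    rw [descend_stoneCechProj]
    exact mul_star_self_nonneg (f.1 p)
  inner_self {f} := by
    rw [← norm_eq_zero, norm_descend, CStarRing.norm_self_mul_star, mul_self_eq_zero, norm_eq_zero,
      Submodule.coe_eq_zero]
  inner_op_smul_right := ext_stoneCechProj hU fun p => by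
    simp [twistedModule_smul_apply, mul_assoc]
  inner_smul_right_complex := ext_stoneCechProj hU fun p => by simp
  star_inner f f' := ext_stoneCechProj hU fun p => by simp [mul_comm]
  norm_eq_sqrt_norm_inner_self f := by
    rw [norm_descend, CStarRing.norm_self_mul_star, Real.sqrt_mul_self (norm_nonneg _)]
    rfl

theorem twistedModule_fibre {hU : Dense (U : Set X)} {g : C(StoneCech U, ℂ)} (f : twistedModule g)
    (p q : StoneCechCorona U) (h : coronaProj hU p = coronaProj hU q) :
    restrictCorona U (star g * f.1) p = restrictCorona U (star g * f.1) q :=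
  f.2 p q (congrArg Subtype.val h)

/-- The map `f ↦ ḡ f` from `twistedModule g` to `C(∂U)`. -/
noncomputable def twistedBoundary (hU : Dense (U : Set X)) {g : C(StoneCech U, ℂ)}
    (f : twistedModule g) : C(frontier (U : Set X), ℂ) :=
  (isQuotientMap_coronaProj hU).lift (restrictCorona U (star g * f.1)) (twistedModule_fibre f)

theorem twistedBoundary_apply (hU : Dense (U : Set X)) {g : C(StoneCech U, ℂ)}
    (f : twistedModule g) (p : StoneCechCorona U) :
    twistedBoundary hU f (coronaProj hU p) = star (g p) * f.1 p :=
  DFunLike.congr_fun ((isQuotientMap_coronaProj hU).lift_comp _ (twistedModule_fibre f)) p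

theorem mem_twistedModule_of_corona (hU : Dense (U : Set X)) {g : C(StoneCech U, ℂ)}
    (f : C(StoneCech U, ℂ)) (z : C(frontier (U : Set X), ℂ))
    (h : ∀ p : StoneCechCorona U, star (g p) * f p = z (coronaProj hU p)) :
    f ∈ twistedModule g := fun p q hpq => by
  obtain rfl | ⟨hp, hq⟩ := stoneCechProj_eq_iff U hpq
  · rfl
  · rw [h ⟨p, hp⟩, h ⟨q, hq⟩]
    exact congrArg z (Subtype.ext hpq)

/-- The Hilbert module extension whose Busby invariant is multiplication by `g`. -/
noncomputable def twistedExtension (hU : Dense (U : Set X)) (g : C(StoneCech U, ℂ))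
    (hg : ∀ p : StoneCechCorona U, g p * star (g p) = 1) :
    Extension (openExtension U hU) C₀(U, ℂ) C(frontier (U : Set X), ℂ) where
  W := twistedModule g
  cstarModule := twistedCStarModule hU hg
  Φ a := ⟨(extendZero U a).comp (stoneCechProj U),
    mem_twistedModule_of_corona hU _ 0 fun p => by
      rw [ContinuousMap.comp_apply, extendZero_stoneCechProj_corona, mul_zero]
      rfl⟩
  Ψ := twistedBoundary hU
  inner_Φ a a' := ext_stoneCechProj hU fun p => by
    refine (descend_stoneCechProj hU _ _ p).trans ?_
    rw [WithCStarModule.inner_def, map_mul, map_star]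
    rfl
  inner_Ψ f f' := by
    ext x
    obtain ⟨p, rfl⟩ := coronaProj_surjective hU x
    refine Eq.trans ?_ (descend_stoneCechProj hU _ (twistedModule_mul_star hg f f') p).symm
    rw [WithCStarModule.inner_def, ContinuousMap.mul_apply, ContinuousMap.star_apply,
      twistedBoundary_apply, twistedBoundary_apply, ContinuousMap.mul_apply,
      ContinuousMap.star_apply, star_mul, star_star]
    linear_combination (f'.1 p * star (f.1 p)) * hg p
  injective a a' h := by
    ext x
    have := DFunLike.congr_fun (congrArg Subtype.val h) (stoneCechUnit x)
    simpa [extendZero_of_mem] using this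
  surjective z := by
    obtain ⟨b, rfl⟩ := (openExtension U hU).surjective z
    -- The preimage of `z` is `g` times the pullback of a lift of `z`, since `ḡ g = 1` on the
    -- corona.
    have h : ∀ p : StoneCechCorona U, star (g p) * (g * b.comp (stoneCechProj U)) p =
        (openExtension U hU).π b (coronaProj hU p) := fun p => by
      change _ = b (stoneCechProj U p)
      rw [ContinuousMap.mul_apply, ContinuousMap.comp_apply]
      linear_combination b (stoneCechProj U p) * hg p
    refine ⟨⟨_, mem_twistedModule_of_corona hU _ _ h⟩, ?_⟩
    ext x
    obtain ⟨p, rfl⟩ := coronaProj_surjective hU x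
    rw [twistedBoundary_apply]
    exact h p
  exact f := by
    constructor
    · intro h
      -- Multiplying `ḡ f = 0` by `g` recovers `f = 0` on the corona.
      have hf : ∀ p : StoneCechCorona U, f.1 p = 0 := fun p => by
        have := twistedBoundary_apply hU f p
        rw [h, ContinuousMap.zero_apply] at this
        linear_combination (-f.1 p) * hg p - g p * this
      obtain ⟨a, ha⟩ := exists_extendZero_eq hU f.1 hf
      exact ⟨a, Subtype.ext <| ContinuousMap.ext ha⟩
    · rintro ⟨a, rfl⟩
      ext x
      obtain ⟨p, rfl⟩ := coronaProj_surjective hU x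
      rw [twistedBoundary_apply, ContinuousMap.comp_apply, extendZero_stoneCechProj_corona,
        mul_zero, ContinuousMap.zero_apply]

/-- Thus the Busby invariant at `Ψ w` has symbol `w` restricted to the corona, and there `w = g · (ḡ
w)`, which is `g` times the pullback of `Ψ w`. -/
theorem twistedExtension_lam (hU : Dense (U : Set X)) (g : C(StoneCech U, ℂ))
    (hg : ∀ p : StoneCechCorona U, g p * star (g p) = 1) (w : twistedModule g) :
    (twistedExtension hU g hg).lam w = stoneCechMult U w.1 := by
  refine Subtype.ext <| ContinuousLinearMap.ext fun a => ZeroAtInftyContinuousMap.ext fun x => ?_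
  have h := DFunLike.congr_fun
    (congrArg Subtype.val ((twistedExtension hU g hg).Φ_lam w a)) (stoneCechUnit x)
  change extendZero U _ (stoneCechProj U (stoneCechUnit x)) =
    extendZero U a (stoneCechProj U (stoneCechUnit x)) * w.1 (stoneCechUnit x) at h
  rw [stoneCechProj_unit, extendZero_of_mem, extendZero_of_mem] at h
  rw [h, stoneCechMult_apply, mul_comm]

theorem exists_extension_isSymbol (hU : Dense (U : Set X)) (u : C(StoneCechCorona U, Circle)) :
    ∃ W : Extension (openExtension U hU) C₀(U, ℂ) C(frontier (U : Set X), ℂ), IsSymbol hU W u := by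
  -- Tietze extends `u` only as a complex-valued function: a circle-valued extension may not exist,
  -- and unimodularity on the corona is enough.
  obtain ⟨g, hgu⟩ := ContinuousMap.exists_extension'
    (isClosed_stoneCechCorona U).isClosedEmbedding_subtypeVal
    (⟨fun p => (u p : ℂ), by fun_prop⟩ : C(StoneCechCorona U, ℂ))
  have hgu' : ∀ p : StoneCechCorona U, g p = u p := fun p => congr_fun hgu p
  have hg : ∀ p : StoneCechCorona U, g p * star (g p) = 1 := fun p => by
    rw [hgu', Complex.star_def, Complex.mul_conj, Circle.normSq_coe, Complex.ofReal_one]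
  refine ⟨twistedExtension hU g hg, fun z p => ?_⟩
  obtain ⟨w, rfl⟩ := (twistedExtension hU g hg).surjective z
  have hΨ : (twistedExtension hU g hg).Ψ w (coronaProj hU p) = star (g p) * w.1 p :=
    twistedBoundary_apply hU w p
  have hb : (twistedExtension hU g hg).busby ((twistedExtension hU g hg).Ψ w) =
      toCorona (stoneCechMult U w.1) :=
    ((twistedExtension hU g hg).busby_Ψ w).trans
      (congrArg toCorona (twistedExtension_lam hU g hg w))
  rw [hb, symbol_stoneCechMult, restrictCorona_apply, hΨ, ← hgu']
  linear_combination (-w.1 p) * hg p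

end Realization

end HilbertExt

/-! ### The bijection on homotopy classes -/

theorem mainTheorem5 {X : Type u} [TopologicalSpace X] [CompactSpace X] [T2Space X]
    (U : TopologicalSpace.Opens X) (hU : Dense (U : Set X)) :
    ∃ Θ : HilbertExt.HomotopyClasses (HilbertExt.openExtension U hU)
        C₀(U, ℂ) C(frontier (U : Set X), ℂ) ≃
      HilbertExt.MapClasses (HilbertExt.StoneCechCorona U) Circle,
      ∀ W : HilbertExt.Extension (HilbertExt.openExtension U hU)
          C₀(U, ℂ) C(frontier (U : Set X), ℂ),
        ∃ u : C(HilbertExt.StoneCechCorona U, Circle),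
          HilbertExt.Represents U u (W.busby 1) ∧
            Θ W.homotopyClass = HilbertExt.mapClass u := by
  choose s hs using fun W => HilbertExt.exists_isSymbol (hU := hU) W
  let θ : HilbertExt.HomotopyClasses (HilbertExt.openExtension U hU)
        C₀(U, ℂ) C(frontier (U : Set X), ℂ) →
      HilbertExt.MapClasses (HilbertExt.StoneCechCorona U) Circle :=
    Quotient.lift (fun W => HilbertExt.mapClass (s W)) fun W W' h =>
      Quotient.sound ((hs W).homotopic_of_homotopic (hs W') h)
  have hθ : Function.Bijective θ := by
    constructor
    · rintro ⟨W⟩ ⟨W'⟩ h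
      exact Quotient.sound ((hs W).homotopic (hs W') (Quotient.exact h))
    · rintro ⟨u⟩
      obtain ⟨W, hW⟩ := HilbertExt.exists_extension_isSymbol hU u
      -- The chosen symbol `s W` is matched with `u` up to homotopy by applying the comparison to
      -- the constant homotopy of `W`.
      exact ⟨W.homotopyClass, Quotient.sound ((hs W).homotopic_of_homotopic hW
        (HilbertExt.Extension.homotopic_equivalence.refl W))⟩
  exact ⟨Equiv.ofBijective θ hθ, fun W => ⟨s W, (hs W).represents, rfl⟩⟩
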